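/- A diffeological space $X$ is a set with a collection of maps $P \to X$ ($P$ open in some $\mathbb{R}^k$), called plots, that contains the constant maps, is stable under precomposition with smooth maps between open subsets of Euclidean spaces, and is local. Write $D(X)$ for the set $X$ with its $D$-topology, the finest topology for which all plots are continuous. Open subsets of Euclidean spaces carry their standard diffeology (plots are the smooth maps), and products carry the product diffeology (a map is a plot if and only if all its components are). For a diffeological space $X$, the free diffeological vector space $F(X)$ is the real vector space $\bigoplus_{x\in X}\mathbb{R}$, with basis elements $[x]$ for $x \in X$, equipped with the diffeology generated by all maps $(\mathbb{R}\times X)^n\to F(X)$, $(r_1,x_1,\dots,r_n,x_n)\mapsto\sum_{i=1}^n r_i[x_i]$, $n\ge 1$. A $k_\omega$-space is a Hausdorff space $Y$ with a countable cover $\{K_n : n\in\mathbb{N}\}$ by compact sets such that a set $A\subseteq Y$ is closed if and only if $A\cap K_n$ is closed in $K_n$ for every $n\in\mathbb{N}$. **Proposition.** Let $U$ and $V$ be open subsets of (possibly different) Euclidean spaces. Then $D(F(U))$ and $D(F(V))$ are $k_\omega$-spaces, and $$D(F(U)\times F(V)) = D(F(U))\times D(F(V)),$$ that is, the $D$-topology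 of the product diffeological space equals the product of the $D$-topologies. More generally, for every finite family $(W_i)_{i\in I}$ of open subsets of Euclidean spaces, each $D(F(W_i))$ is a $k_\omega$-space and $$D\Big(\prod_{i\in I}F(W_i)\Big)=\prod_{i\in I}D(F(W_i)).$$ -/

import Mathlib

open Diffeology

noncomputable section

/-- The subspace diffeology: a map into a subtype is a plot iff it is a plot of the ambient space.
Its `D`-topology is the default one, namely the finest topology making all plots continuous. -/
instance subtypeDiffeology {X : Type*} [DiffeologicalSpace X] (P : X → Prop) :
    DiffeologicalSpace {x : X // P x} where
  plots _ := {p | IsPlot fun t => (p t : X)}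
  constant_plots x := DiffeologicalSpace.constant_plots (x : X)
  plot_reparam hp hf := DiffeologicalSpace.plot_reparam hp hf
  locality hp := DiffeologicalSpace.locality hp

/-- The product diffeology on a binary product: a map is a plot iff both components are plots. -/
instance prodDiffeology {X Y : Type*} [DiffeologicalSpace X] [DiffeologicalSpace Y] :
    DiffeologicalSpace (X × Y) where
  plots _ := {p | (IsPlot fun t => (p t).1) ∧ IsPlot fun t => (p t).2}
  constant_plots x :=
    ⟨DiffeologicalSpace.constant_plots x.1, DiffeologicalSpace.constant_plots x.2⟩
  plot_reparam hp hf :=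
    ⟨DiffeologicalSpace.plot_reparam hp.1 hf, DiffeologicalSpace.plot_reparam hp.2 hf⟩
  locality hp :=
    ⟨DiffeologicalSpace.locality fun x =>
        let ⟨u, hu, hx, h⟩ := hp x
        ⟨u, hu, hx, fun hfu hf => (h hfu hf).1⟩,
      DiffeologicalSpace.locality fun x =>
        let ⟨u, hu, hx, h⟩ := hp x
        ⟨u, hu, hx, fun hfu hf => (h hfu hf).2⟩⟩

/-- The product diffeology on an arbitrary product: a map is a plot iff every component is. -/
instance piDiffeology {ι : Type*} {X : ι → Type*} [∀ i, DiffeologicalSpace (X i)] :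
    DiffeologicalSpace (∀ i, X i) where
  plots _ := {p | ∀ i, IsPlot fun t => p t i}
  constant_plots x i := DiffeologicalSpace.constant_plots (x i)
  plot_reparam hp hf i := DiffeologicalSpace.plot_reparam (hp i) hf
  locality hp i := DiffeologicalSpace.locality fun x =>
    let ⟨u, hu, hx, h⟩ := hp x
    ⟨u, hu, hx, fun hfu hf => h hfu hf i⟩

/-- The underlying real vector space `⨁_{x ∈ X} ℝ` of the free diffeological vector space
generated by `X`. -/
abbrev FreeDVS (X : Type*) : Type _ := X →₀ ℝ

/-- The map `ρ_n : (ℝ × X)^n → F(X)`, `(r_1, x_1, …, r_n, x_n) ↦ ∑ r_i [x_i]`. -/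
def FreeDVS.rho (X : Type*) (n : ℕ) (a : Fin n → ℝ × X) : FreeDVS X :=
  ∑ i, Finsupp.single (a i).2 (a i).1

/-- The diffeology of the free diffeological vector space `F(X)`: the one generated by all the
maps `ρ_n : (ℝ × X)^n → F(X)` with `n > 0`, that is, by the composites of the `ρ_n` with the plots
of the product diffeological space `(ℝ × X)^n`. -/
instance FreeDVS.diffeology (X : Type*) [DiffeologicalSpace X] :
    DiffeologicalSpace (FreeDVS X) :=
  DiffeologicalSpace.generateFrom
    {g | ∃ n : ℕ, 0 < n ∧ ∃ (k : ℕ) (q : EuclideanSpace ℝ (Fin k) → (Fin n → ℝ × X)),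
      IsPlot q ∧ g = ⟨k, FreeDVS.rho X n ∘ q⟩}

/-- The topology `t` on `X` is that of a `k_ω`-space: it is Hausdorff and there is a countable
cover `(K n)` by compact sets such that a set `F` is closed iff each `F ∩ K n` is closed
in `K n`. -/
def IsKOmega {X : Type*} (t : TopologicalSpace X) : Prop :=
  T2Space X ∧ ∃ K : ℕ → Set X, (∀ n, IsCompact (K n)) ∧ (⋃ n, K n) = Set.univ ∧
    ∀ F : Set X, IsClosed F ↔ ∀ n, IsClosed ((fun x : K n => (x : X)) ⁻¹' F)

end

/-! ### Topology: finite products of spaces exhausted by compact sets. -/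

section Topology

open Set Filter Topology

/-! The disjoint union `Param W` of the spaces `(ℝ × W)^n` is locally compact and σ-compact, and
`quot W` exhibits `D(F(W))` as its topological quotient, because `D`-open subsets of Euclidean open
sets are open. Continuous functions on `W` extend to continuous functionals separating points of
`F(W)`, so the quotient is Hausdorff; images of a compact exhaustion then make it `k_ω`. Finite
products of such quotient maps are again quotient maps. A `D`-open set of the product pulls back to
an open set of parameters, so it is open in the product topology; smoothness of the projections
gives the converse. -/

theorem IsCompact.exists_mem_le_nhds_of_le_nhdsSet {X : Type*} [TopologicalSpace X] {s : Set X}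
    (hs : IsCompact s) {F : Ultrafilter X} (hF : (F : Filter X) ≤ 𝓝ˢ s) :
    ∃ x ∈ s, (F : Filter X) ≤ 𝓝 x := by
  by_contra! h
  have hd : Disjoint (𝓝ˢ s) (F : Filter X) := hs.disjoint_nhdsSet_left.2 fun x hx =>
    (Ultrafilter.disjoint_iff_not_le.2 (h x hx)).symm
  exact F.neBot.ne (disjoint_self.1 (hd.mono_left hF))

/-- The tube lemma for products of finitely many compact sets. -/
theorem exists_isOpen_pi_subset_of_isCompact {ι : Type*} [Finite ι] {X : ι → Type*}
    [∀ i, TopologicalSpace (X i)] {N : ∀ i, Set (X i)} (hN : ∀ i, IsCompact (N i))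
    {O : Set (∀ i, X i)} (hO : IsOpen O) (h : univ.pi N ⊆ O) :
    ∃ G : ∀ i, Set (X i), (∀ i, IsOpen (G i)) ∧ (∀ i, N i ⊆ G i) ∧ univ.pi G ⊆ O := by
  have key : O ∈ Filter.pi fun i => 𝓝ˢ (N i) := by
    -- An ultrafilter finer than the product of the `𝓝ˢ (N i)` converges to a point of the box.
    rw [mem_iff_ultrafilter]
    intro F hF
    have (i : ι) : ∃ x ∈ N i, ((F.map (Function.eval i) : Ultrafilter (X i)) : Filter (X i)) ≤ 𝓝 x :=
      (hN i).exists_mem_le_nhds_of_le_nhdsSet ((tendsto_eval_pi _ i).mono_left hF)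
    choose x hxN hx using this
    have hFx : (F : Filter (∀ i, X i)) ≤ 𝓝 x := by
      rw [nhds_pi]
      exact le_pi.2 hx
    exact hFx (hO.mem_nhds (h fun i _ => hxN i))
  obtain ⟨I, -, t, ht, hsub⟩ := mem_pi.1 key
  choose G hG hNG hGt using fun i => mem_nhdsSet_iff_exists.1 (ht i)
  exact ⟨G, hG, hNG, fun f hf => hsub fun i _ => hGt i (hf i (mem_univ i))⟩

/-- Separate `N` from the compact set `K \ G` by open sets `O` and `H`, and take `M = K \ H`. -/
theorem IsCompact.exists_isOpen_inter_subset_isCompact {X : Type*} [TopologicalSpace X] [T2Space X]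
    {K N G : Set X} (hK : IsCompact K) (hN : IsCompact N) (hG : IsOpen G) (hNG : N ⊆ G) :
    ∃ O M : Set X, IsOpen O ∧ IsCompact M ∧ N ⊆ O ∧ O ∩ K ⊆ M ∧ M ⊆ G ∩ K := by
  obtain ⟨O, H, hO, hH, hNO, hKH, hOH⟩ := SeparatedNhds.of_isCompact_isCompact hN (hK.diff hG)
    (disjoint_left.2 fun x hx hx' => hx'.2 (hNG hx))
  refine ⟨O, K \ H, hO, hK.diff hH, hNO, fun x hx => ⟨hx.2, disjoint_left.1 hOH hx.1⟩,
    fun x hx => ⟨?_, hx.1⟩⟩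
  by_contra hxG
  exact hx.2 (hKH ⟨hx.1, hxG⟩)

/-- A finite product of Hausdorff spaces, each of which is the colimit of an increasing sequence
of compact subspaces, is the colimit of the products of these subspaces. -/
theorem isOpen_pi_of_forall_isCompact_seq {ι : Type*} [Finite ι] {X : ι → Type*}
    [∀ i, TopologicalSpace (X i)] [∀ i, T2Space (X i)] {K : ∀ i, ℕ → Set (X i)}
    (hK : ∀ i n, IsCompact (K i n)) (hmono : ∀ i, Monotone (K i)) (hcov : ∀ i x, ∃ n, x ∈ K i n)
    (hopen : ∀ i (V : Set (X i)), (∀ n, ∃ O, IsOpen O ∧ V ∩ K i n = O ∩ K i n) → IsOpen V)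
    {A : Set (∀ i, X i)}
    (hA : ∀ n, ∃ O, IsOpen O ∧ A ∩ univ.pi (fun i => K i n) = O ∩ univ.pi fun i => K i n) :
    IsOpen A := by
  classical
  cases nonempty_fintype ι
  refine isOpen_iff_forall_mem_open.2 fun a ha => ?_
  choose n hn using fun i => hcov i (a i)
  let n₀ := Finset.univ.sup n
  have hn₀ (i : ι) : a i ∈ K i n₀ := hmono i (Finset.le_sup (Finset.mem_univ i)) (hn i)
  -- A compact box in `A` at stage `k` is thickened to one at stage `k + 1` that is a relative
  -- neighbourhood of it. Iterating from `{a}` and taking unions gives an open box in `A`.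
  have step (k : ℕ) (N : ∀ i, Set (X i)) (hN : ∀ i, IsCompact (N i)) (hNK : ∀ i, N i ⊆ K i k)
      (hNA : univ.pi N ⊆ A) : ∃ M O : ∀ i, Set (X i), (∀ i, IsCompact (M i)) ∧
        (∀ i, M i ⊆ K i (k + 1)) ∧ univ.pi M ⊆ A ∧ (∀ i, IsOpen (O i)) ∧ (∀ i, N i ⊆ O i) ∧
        ∀ i, O i ∩ K i (k + 1) ⊆ M i := by
    obtain ⟨O, hO, hAO⟩ := hA (k + 1)
    have hsub : univ.pi N ⊆ O := fun f hf =>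
      (hAO.subset ⟨hNA hf, fun i _ => hmono i k.le_succ (hNK i (hf i (mem_univ i)))⟩).1
    obtain ⟨G, hG, hNG, hGO⟩ := exists_isOpen_pi_subset_of_isCompact hN hO hsub
    choose P M hP hM hNP hPM hMG using fun i =>
      (hK i (k + 1)).exists_isOpen_inter_subset_isCompact (hN i) (hG i) (hNG i)
    exact ⟨M, P, hM, fun i => (hMG i).trans inter_subset_right, fun f hf =>
      (hAO.superset ⟨hGO fun i _ => (hMG i (hf i (mem_univ i))).1,
        fun i _ => (hMG i (hf i (mem_univ i))).2⟩).1, hP, hNP, hPM⟩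
  choose! M O hM hMK hMA hO hNO hOM using step
  let N : ℕ → ∀ i, Set (X i) := fun k => Nat.rec (fun i => {a i}) (fun k N => M (n₀ + k) N) k
  have hN (k : ℕ) : (∀ i, IsCompact (N k i)) ∧ (∀ i, N k i ⊆ K i (n₀ + k)) ∧ univ.pi (N k) ⊆ A := by
    induction k with
    | zero =>
      refine ⟨fun i => isCompact_singleton, fun i => singleton_subset_iff.2 (hn₀ i), fun f hf => ?_⟩
      have : f = a := funext fun i => hf i (mem_univ i)
      exact this ▸ ha
    | succ k ih =>
      exact ⟨hM _ _ ih.1 ih.2.1 ih.2.2, hMK _ _ ih.1 ih.2.1 ih.2.2, hMA _ _ ih.1 ih.2.1 ih.2.2⟩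
  let P : ℕ → ∀ i, Set (X i) := fun k => O (n₀ + k) (N k)
  have hP (k : ℕ) (i : ι) : IsOpen (P k i) := hO _ _ (hN k).1 (hN k).2.1 (hN k).2.2 i
  have hNP (k : ℕ) (i : ι) : N k i ⊆ P k i := hNO _ _ (hN k).1 (hN k).2.1 (hN k).2.2 i
  have hPN (k : ℕ) (i : ι) : P k i ∩ K i (n₀ + k + 1) ⊆ N (k + 1) i :=
    hOM _ _ (hN k).1 (hN k).2.1 (hN k).2.2 i
  have hNmono (i : ι) : Monotone fun k => N k i := monotone_nat_of_le_succ fun k x hx =>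
    hPN k i ⟨hNP k i hx, hmono i (Nat.le_succ _) ((hN k).2.1 i hx)⟩
  refine ⟨univ.pi fun i => ⋃ k, N k i, fun f hf => ?_,
    isOpen_set_pi finite_univ fun i _ => hopen i _ fun m => ?_,
    fun i _ => mem_iUnion.2 ⟨0, rfl⟩⟩
  · choose k hk using fun i => mem_iUnion.1 (hf i (mem_univ i))
    exact (hN (Finset.univ.sup k)).2.2 fun i _ =>
      hNmono i (Finset.le_sup (Finset.mem_univ i)) (hk i)
  -- Only `k ≥ m` is allowed, so that `K i m ⊆ K i (n₀ + k + 1)`, where `P k i` is controlled.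
  · refine ⟨⋃ k ∈ Ici m, P k i, isOpen_biUnion fun k _ => hP k i, subset_antisymm ?_ ?_⟩
    · rintro x ⟨hx, hxK⟩
      obtain ⟨k, hk⟩ := mem_iUnion.1 hx
      exact ⟨mem_biUnion (le_max_right k m) (hNP _ i (hNmono i (le_max_left k m) hk)), hxK⟩
    · rintro x ⟨hx, hxK⟩
      obtain ⟨k, hk, hxk⟩ := mem_iUnion₂.1 hx
      have hk' : m ≤ k := hk
      exact ⟨mem_iUnion.2 ⟨k + 1, hPN k i ⟨hxk, hmono i (by omega) hxK⟩⟩, hxK⟩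

/-! ### Hausdorff quotients of locally compact σ-compact spaces. -/

variable {M X : Type*} [TopologicalSpace M] [tX : TopologicalSpace X]

/-- The images of a compact exhaustion under a quotient map determine the topology. -/
theorem Topology.IsQuotientMap.isClosed_of_inter_image_compactExhaustion [T2Space X] {q : M → X}
    (hq : IsQuotientMap q) (C : CompactExhaustion M) {F : Set X}
    (hF : ∀ n, ∃ E, IsClosed E ∧ F ∩ q '' C n = E ∩ q '' C n) : IsClosed F := by
  rw [← hq.isClosed_preimage, isClosed_iff_frequently]
  intro z hz
  obtain ⟨n, hn⟩ := C.exists_mem_nhds z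
  obtain ⟨E, hE, hFE⟩ := hF n
  have hzE : z ∈ q ⁻¹' E := by
    refine (hE.preimage hq.continuous).mem_of_frequently_of_tendsto ?_ tendsto_id
    exact (hz.and_eventually hn).mono fun y hy => (hFE.subset ⟨hy.1, mem_image_of_mem q hy.2⟩).1
  exact (hFE.superset ⟨hzE, mem_image_of_mem q (mem_of_mem_nhds hn)⟩).1

theorem Topology.IsQuotientMap.isKOmega [WeaklyLocallyCompactSpace M] [SigmaCompactSpace M]
    [T2Space X] {q : M → X} (hq : IsQuotientMap q) : IsKOmega tX := by
  let C : CompactExhaustion M := default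
  refine ⟨inferInstance, fun n => q '' C n, fun n => (C.isCompact n).image hq.continuous, ?_,
    fun F => ⟨fun hF n => hF.preimage continuous_subtype_val, fun hF =>
      hq.isClosed_of_inter_image_compactExhaustion C fun n => ?_⟩⟩
  · rw [← image_iUnion, C.iUnion_eq, image_univ, hq.surjective.range_eq]
  · obtain ⟨E, hE, h⟩ := isClosed_induced_iff.1 (hF n)
    exact ⟨E, hE, by simpa [inter_comm] using (Subtype.preimage_coe_eq_preimage_coe_iff.1 h).symm⟩

theorem Topology.IsQuotientMap.piMap_of_sigmaCompactSpace {ι : Type*} [Finite ι] {M X : ι → Type*}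
    [∀ i, TopologicalSpace (M i)] [∀ i, TopologicalSpace (X i)]
    [∀ i, WeaklyLocallyCompactSpace (M i)] [∀ i, SigmaCompactSpace (M i)] [∀ i, T2Space (X i)]
    {q : ∀ i, M i → X i} (hq : ∀ i, IsQuotientMap (q i)) : IsQuotientMap (Pi.map q) := by
  have hcont : Continuous (Pi.map q) := Continuous.piMap fun i => (hq i).continuous
  refine ⟨isCoinducing_iff.2 fun A => ⟨fun hA => ?_, fun hA => hA.preimage hcont⟩,
    Function.Surjective.piMap fun i => (hq i).surjective⟩
  let C : ∀ i, CompactExhaustion (M i) := fun i => default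
  refine isOpen_pi_of_forall_isCompact_seq (K := fun i n => q i '' C i n)
    (fun i n => ((C i).isCompact n).image (hq i).continuous)
    (fun i m n hmn => image_mono ((C i).subset hmn)) (fun i x => ?_) (fun i V hV => ?_) fun n => ?_
  · obtain ⟨z, rfl⟩ := (hq i).surjective x
    obtain ⟨n, hn⟩ := (C i).exists_mem z
    exact ⟨n, mem_image_of_mem _ hn⟩
  · rw [← isClosed_compl_iff]
    refine (hq i).isClosed_of_inter_image_compactExhaustion (C i) fun n => ?_
    obtain ⟨O, hO, hVO⟩ := hV n
    refine ⟨Oᶜ, hO.isClosed_compl, ?_⟩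
    ext x
    have := Set.ext_iff.1 hVO x
    simp only [mem_inter_iff, mem_compl_iff] at this ⊢
    tauto
  -- On the compact box of parameters, the part outside `A` has compact, hence closed, image; its
  -- complement has the same trace as `A`.
  · have hc : IsCompact (Pi.map q '' (univ.pi (fun i => C i n) ∩ (Pi.map q ⁻¹' A)ᶜ)) :=
      ((isCompact_univ_pi fun i => (C i).isCompact n).inter_right hA.isClosed_compl).image hcont
    refine ⟨_, hc.isClosed.isOpen_compl, ?_⟩
    ext f
    simp only [mem_inter_iff, mem_compl_iff, and_congr_left_iff]
    intro hf
    constructor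
    · rintro hfA ⟨z, hz, rfl⟩
      exact hz.2 hfA
    · intro hfA
      by_contra hf'
      choose z hzC hz using fun i => hf i (mem_univ i)
      have hzf : Pi.map q z = f := funext hz
      exact hfA ⟨z, ⟨fun i _ => hzC i, fun h => hf' (hzf ▸ h)⟩, hzf⟩

theorem Sigma.weaklyLocallyCompactSpace {ι : Type*} {X : ι → Type*} [∀ i, TopologicalSpace (X i)]
    [∀ i, WeaklyLocallyCompactSpace (X i)] : WeaklyLocallyCompactSpace (Σ i, X i) where
  exists_compact_mem_nhds := by
    rintro ⟨i, x⟩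
    obtain ⟨K, hK, hx⟩ := exists_compact_mem_nhds x
    exact ⟨Sigma.mk i '' K, hK.image continuous_sigmaMk, isOpenMap_sigmaMk.image_mem_nhds hx⟩

end Topology

/-! ### `D`-topologies and generated diffeologies. -/

section Diffeology

open Set Filter Topology ContDiff

/-- Plots are defined on whole Euclidean spaces, so a small ball around `j z` is parametrized by
`univBall`. This gives an open plot through `z`. -/
theorem isOpen_of_isOpen_dTopology {M E : Type*} [TopologicalSpace M] [DiffeologicalSpace M]
    [NormedAddCommGroup E] [NormedSpace ℝ E] [FiniteDimensional ℝ E] {j : M → E}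
    (hj : IsOpenEmbedding j)
    (hplot : ∀ (k : ℕ) (p : EuclideanSpace ℝ (Fin k) → M), ContDiff ℝ ∞ (j ∘ p) → IsPlot p)
    {A : Set M} (hA : IsOpen[dTopology] A) : IsOpen A := by
  refine isOpen_iff_mem_nhds.2 fun z hz => ?_
  let e := toEuclidean (E := E)
  obtain ⟨r, hr, hball⟩ := Metric.isOpen_iff.1 (hj.isOpen_range.preimage e.symm.continuous) (e (j z))
    (by simp)
  let g := OpenPartialHomeomorph.univBall (E := EuclideanSpace ℝ (Fin (Module.finrank ℝ E)))
    (e (j z)) r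
  have hg (t) : g t ∈ Metric.ball (e (j z)) r := by
    rw [← OpenPartialHomeomorph.univBall_target _ hr]
    exact g.map_source (by simp [g])
  choose p hp using fun t => hball (hg t)
  have hjp : j ∘ p = e.symm ∘ g := funext hp
  have hpplot : IsPlot p := hplot _ p <| by
    rw [hjp]
    exact e.symm.contDiff.comp OpenPartialHomeomorph.contDiff_univBall
  have hopen : IsOpen (p ⁻¹' A) := isOpen_iff_preimages_plots.1 hA _ p hpplot
  have hp0 : p 0 = z := hj.injective <| by simpa [g] using hp 0
  have himage : IsOpen (p '' (p ⁻¹' A)) := by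
    rw [hj.isOpen_iff_image_isOpen, ← image_comp, hjp, image_comp]
    refine e.symm.toHomeomorph.isOpenMap _ ?_
    exact g.isOpen_image_of_subset_source hopen (by simp [g])
  exact mem_of_superset (himage.mem_nhds ⟨0, by simpa [hp0] using hz, hp0⟩)
    (image_preimage_subset p A)

theorem Diffeology.DSmooth.isOpen_preimage_dTopology {X Y : Type*} [DiffeologicalSpace X]
    [DiffeologicalSpace Y] {f : X → Y} (hf : DSmooth f) {A : Set Y} (hA : IsOpen[dTopology] A) :
    IsOpen[dTopology] (f ⁻¹' A) :=
  @Continuous.isOpen_preimage _ _ dTopology dTopology f hf.continuous A hA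

/-- The diffeology whose plots are the continuous maps. -/
abbrev continuousDiffeology {X : Type*} (t : TopologicalSpace X) : DiffeologicalSpace X :=
  .ofCorePlotsOn {
    isPlotOn := fun {_ u} _ p => ContinuousOn p u
    isPlotOn_congr := fun _ _ _ h => continuousOn_congr h
    isPlot := fun p => Continuous p
    isPlotOn_univ := continuousOn_univ
    isPlot_const := fun _ => continuous_const
    isPlotOn_reparam := fun _ _ _ h hp hf => hp.comp hf.continuousOn h
    locality := fun _ _ h x hx =>
      let ⟨_, hv, hxv, hp⟩ := h x hx
      (hp.continuousAt (hv.mem_nhds hxv)).continuousWithinAt }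

/-- Plots of a generated diffeology are plots of every diffeology containing the generators, here
`continuousDiffeology t`. -/
theorem continuous_of_isPlot_generateFrom {X : Type*} {t : TopologicalSpace X}
    {g : Set ((n : ℕ) × (EuclideanSpace ℝ (Fin n) → X))} (hg : ∀ p ∈ g, Continuous p.2) {k : ℕ}
    {p : EuclideanSpace ℝ (Fin k) → X} (hp : @IsPlot X (.generateFrom g) k p) : Continuous p :=
  hp (continuousDiffeology t) fun q hq => hg q hq

end Diffeology

/-! ### Free diffeological vector spaces. -/

namespace FreeDVS

open Set Filter Topology ContDiff

variable {d : ℕ} {W : TopologicalSpace.Opens (EuclideanSpace ℝ (Fin d))}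

/-- The parameters `(r_1, x_1, …, r_n, x_n)` of the maps `ρ_n`, for all `n`. -/
abbrev Param (X : Type*) : Type _ := Σ n : ℕ, Fin n → ℝ × X

/-- All the maps `ρ_n` together. -/
noncomputable def quot (X : Type*) (a : Param X) : FreeDVS X := rho X a.1 a.2

theorem quot_surjective (X : Type*) : Function.Surjective (quot X) := fun v => by
  classical
  refine ⟨⟨v.support.card, fun i => (v (v.support.equivFin.symm i), v.support.equivFin.symm i)⟩, ?_⟩
  simp only [quot, rho]
  rw [Equiv.sum_comp v.support.equivFin.symm
    fun x : v.support => Finsupp.single (x : X) (v x),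
    Finset.sum_coe_sort v.support fun x => Finsupp.single x (v x)]
  exact v.sum_single

theorem dSmooth_rho (X : Type*) [DiffeologicalSpace X] (n : ℕ) : DSmooth (rho X n) := by
  intro k q hq
  -- The generators require `n > 0`, but `ρ_0` is constant.
  rcases n.eq_zero_or_pos with rfl | hn
  · have : rho X 0 ∘ q = fun _ => 0 := funext fun t => by simp [rho]
    rw [this]
    exact isPlot_const
  · exact DiffeologicalSpace.isPlot_generatedFrom_of_mem ⟨n, hn, k, q, hq, rfl⟩

/-- The inclusion of the parameter space of `ρ_n` into a vector space. -/
def paramVal (W : TopologicalSpace.Opens (EuclideanSpace ℝ (Fin d))) (n : ℕ) :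
    (Fin n → ℝ × W) → Fin n → ℝ × EuclideanSpace ℝ (Fin d) :=
  Pi.map fun _ => Prod.map id Subtype.val

theorem isOpenEmbedding_paramVal (n : ℕ) : IsOpenEmbedding (paramVal W n) :=
  .piMap fun _ => .prodMap .id W.isOpen.isOpenEmbedding_subtypeVal

theorem isPlot_param_iff {n k : ℕ} {q : EuclideanSpace ℝ (Fin k) → Fin n → ℝ × W} :
    IsPlot q ↔ ContDiff ℝ ∞ (paramVal W n ∘ q) := by
  rw [contDiff_pi]
  refine forall_congr' fun i => ?_
  refine ⟨fun h => (isPlot_iff_contDiff.1 h.1).prodMk ?_, fun h => ⟨isPlot_iff_contDiff.2 h.fst, ?_⟩⟩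
  · have h₂ : IsPlot fun t => ((q t i).2 : EuclideanSpace ℝ (Fin d)) := h.2
    exact isPlot_iff_contDiff.1 h₂
  · change IsPlot fun t => ((q t i).2 : EuclideanSpace ℝ (Fin d))
    exact isPlot_iff_contDiff.2 h.snd

theorem isOpen_param_of_dTopology {n : ℕ} {A : Set (Fin n → ℝ × W)} (hA : IsOpen[dTopology] A) :
    IsOpen A :=
  isOpen_of_isOpen_dTopology (isOpenEmbedding_paramVal n) (fun _ _ => isPlot_param_iff.2) hA

theorem isOpen_pi_param_of_dTopology {ι : Type*} [Finite ι] {d : ι → ℕ}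
    {W : ∀ i, TopologicalSpace.Opens (EuclideanSpace ℝ (Fin (d i)))} {ν : ι → ℕ}
    {A : Set (∀ i, Fin (ν i) → ℝ × W i)} (hA : IsOpen[dTopology] A) : IsOpen A := by
  cases nonempty_fintype ι
  exact isOpen_of_isOpen_dTopology (.piMap fun i => isOpenEmbedding_paramVal (W := W i) (ν i))
    (fun _ _ h i => isPlot_param_iff.2 (contDiff_pi.1 h i)) hA

theorem isOpen_dTopology_iff {A : Set (FreeDVS W)} :
    IsOpen[dTopology] A ↔ IsOpen (quot W ⁻¹' A) := by
  rw [isOpen_sigma_iff]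
  refine ⟨fun hA n => isOpen_param_of_dTopology
    ((dSmooth_rho W n).isOpen_preimage_dTopology hA), fun hA => ?_⟩
  refine Diffeology.isOpen_iff_preimages_plots.2 fun k p hp => ?_
  -- The generators are continuous for the quotient topology, hence so are all plots.
  let t : TopologicalSpace (FreeDVS W) := .coinduced (quot W) inferInstance
  have hcont : Continuous p := by
    refine continuous_of_isPlot_generateFrom ?_ hp
    rintro _ ⟨n, -, k, q, hq, rfl⟩
    have hq' : Continuous q :=
      (isOpenEmbedding_paramVal n).continuous_iff.2 (isPlot_param_iff.1 hq).continuous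
    have hmk : Continuous (@Sigma.mk ℕ (fun n => Fin n → ℝ × W) n) := continuous_sigmaMk
    have hquot : Continuous (quot W) := continuous_coinduced_rng
    exact (hquot.comp hmk).comp hq'
  exact hcont.isOpen_preimage A (isOpen_coinduced.2 (isOpen_sigma_iff.2 hA))

theorem isQuotientMap_quot : @IsQuotientMap _ _ _ dTopology (quot W) :=
  let : TopologicalSpace (FreeDVS W) := dTopology
  ⟨isCoinducing_iff.2 fun _ => isOpen_dTopology_iff.symm, quot_surjective W⟩

theorem continuous_linearCombination {f : W → ℝ} (hf : Continuous f) :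
    @Continuous _ _ dTopology _ (Finsupp.linearCombination ℝ f) := by
  let : TopologicalSpace (FreeDVS W) := dTopology
  rw [isQuotientMap_quot.continuous_iff, continuous_sigma_iff]
  intro n
  have : (fun a => (Finsupp.linearCombination ℝ f ∘ quot W) ⟨n, a⟩) =
      fun a : Fin n → ℝ × W => ∑ i, (a i).1 * f (a i).2 := by
    ext a
    simp [quot, rho, map_sum, Finsupp.linearCombination_single]
  rw [this]
  fun_prop

theorem exists_continuous_linearCombination_ne_zero {v : FreeDVS W} (hv : v ≠ 0) :
    ∃ f : W → ℝ, Continuous f ∧ Finsupp.linearCombination ℝ f v ≠ 0 := by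
  classical
  obtain ⟨x, hx⟩ := Finsupp.support_nonempty_iff.2 hv
  -- This product vanishes at every support point except `x`.
  refine ⟨fun y => ∏ z ∈ v.support.erase x, dist y z, by fun_prop, ?_⟩
  rw [Finsupp.linearCombination_apply, Finsupp.sum, Finset.sum_eq_single_of_mem x hx]
  · refine smul_ne_zero (Finsupp.mem_support_iff.1 hx) (Finset.prod_ne_zero_iff.2 fun z hz => ?_)
    exact dist_ne_zero.2 (Finset.ne_of_mem_erase hz).symm
  · intro y hy hyx
    rw [Finset.prod_eq_zero (Finset.mem_erase.2 ⟨hyx, hy⟩) (dist_self y), smul_zero]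

theorem t2Space_dTopology : @T2Space (FreeDVS W) dTopology := by
  let : TopologicalSpace (FreeDVS W) := dTopology
  refine ⟨fun v w hvw => ?_⟩
  obtain ⟨f, hf, hne⟩ := exists_continuous_linearCombination_ne_zero (sub_ne_zero.2 hvw)
  rw [map_sub, sub_ne_zero] at hne
  exact separated_by_continuous (continuous_linearCombination hf) hne

theorem weaklyLocallyCompactSpace_param : WeaklyLocallyCompactSpace (Param W) :=
  have : LocallyCompactSpace W := W.isOpen.locallyCompactSpace
  Sigma.weaklyLocallyCompactSpace

theorem sigmaCompactSpace_param : SigmaCompactSpace (Param W) :=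
  have : LocallyCompactSpace W := W.isOpen.locallyCompactSpace
  inferInstance

theorem isKOmega_dTopology (W : TopologicalSpace.Opens (EuclideanSpace ℝ (Fin d))) :
    IsKOmega (dTopology : TopologicalSpace (FreeDVS W)) :=
  let : TopologicalSpace (FreeDVS W) := dTopology
  have := t2Space_dTopology (W := W)
  have := weaklyLocallyCompactSpace_param (W := W)
  have := sigmaCompactSpace_param (W := W)
  isQuotientMap_quot.isKOmega

theorem dTopology_pi {ι : Type*} [Finite ι] (d : ι → ℕ)
    (W : ∀ i, TopologicalSpace.Opens (EuclideanSpace ℝ (Fin (d i)))) :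
    (dTopology : TopologicalSpace (∀ i, FreeDVS (W i))) =
      @Pi.topologicalSpace ι (fun i => FreeDVS (W i)) (fun _ => dTopology) := by
  let (i : ι) : TopologicalSpace (FreeDVS (W i)) := dTopology
  have (i : ι) := t2Space_dTopology (W := W i)
  have (i : ι) := weaklyLocallyCompactSpace_param (W := W i)
  have (i : ι) := sigmaCompactSpace_param (W := W i)
  refine le_antisymm ?_ fun A hA => ?_
  · refine le_iInf fun i => continuous_iff_le_induced.1 ?_
    exact DSmooth.continuous (X := ∀ i, FreeDVS (W i)) fun _ _ hp => hp i
  · have hq : IsQuotientMap (Pi.map fun i => quot (W i)) :=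
      .piMap_of_sigmaCompactSpace fun i => isQuotientMap_quot
    refine hq.isOpen_preimage.1 (isOpen_iff_mem_nhds.2 fun a ha => ?_)
    -- Near `a` the number of summands in each factor is fixed, so openness is tested on one
    -- finite-dimensional stratum.
    have he : IsOpenEmbedding
        (Pi.map fun i => @Sigma.mk ℕ (fun n => Fin n → ℝ × W i) (a i).1) :=
      .piMap fun i => IsOpenEmbedding.sigmaMk (σ := fun n => Fin n → ℝ × W i)
    have hsmooth : DSmooth (Pi.map fun i => rho (W i) (a i).1) :=
      fun k p hp i => dSmooth_rho (W i) _ k _ (hp i)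
    have hopen := isOpen_pi_param_of_dTopology (hsmooth.isOpen_preimage_dTopology hA)
    exact mem_of_superset ((he.isOpenMap _ hopen).mem_nhds ⟨fun i => (a i).2, ha, rfl⟩)
      (by rintro _ ⟨b, hb, rfl⟩; exact hb)

/-- Indexing by `Bool` reduces the binary case to `dTopology_pi`: `f` is smooth, and its inverse `g`
is continuous for the product topologies. -/
theorem dTopology_prod_bool {d : Bool → ℕ}
    (W : ∀ b, TopologicalSpace.Opens (EuclideanSpace ℝ (Fin (d b)))) :
    (dTopology : TopologicalSpace (FreeDVS (W false) × FreeDVS (W true))) =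
      @instTopologicalSpaceProd (FreeDVS (W false)) (FreeDVS (W true)) dTopology dTopology := by
  let (b : Bool) : TopologicalSpace (FreeDVS (W b)) := dTopology
  refine le_antisymm (le_inf ?_ ?_) fun A hA => ?_
  · refine continuous_iff_le_induced.1 ?_
    exact DSmooth.continuous (X := FreeDVS (W false) × FreeDVS (W true)) fun _ _ hp => hp.1
  · refine continuous_iff_le_induced.1 ?_
    exact DSmooth.continuous (X := FreeDVS (W false) × FreeDVS (W true)) fun _ _ hp => hp.2
  · let f : (∀ b, FreeDVS (W b)) → FreeDVS (W false) × FreeDVS (W true) :=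
      fun v => (v false, v true)
    let g : FreeDVS (W false) × FreeDVS (W true) → ∀ b, FreeDVS (W b) :=
      fun v b => match b with
        | false => v.1
        | true => v.2
    have hf : DSmooth f := fun _ _ hp => ⟨hp false, hp true⟩
    have hA' : IsOpen[dTopology] (f ⁻¹' A) := hf.isOpen_preimage_dTopology hA
    rw [dTopology_pi] at hA'
    have hg : Continuous g := continuous_pi <| by
      rintro (_ | _)
      exacts [continuous_fst, continuous_snd]
    exact hg.isOpen_preimage _ hA'

theorem dTopology_prod {m n : ℕ} (U : TopologicalSpace.Opens (EuclideanSpace ℝ (Fin m)))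
    (V : TopologicalSpace.Opens (EuclideanSpace ℝ (Fin n))) :
    (dTopology : TopologicalSpace (FreeDVS U × FreeDVS V)) =
      @instTopologicalSpaceProd (FreeDVS U) (FreeDVS V) dTopology dTopology :=
  dTopology_prod_bool (d := fun b => Bool.rec m n b)
    (Bool.rec U V : ∀ b : Bool, TopologicalSpace.Opens (EuclideanSpace ℝ (Fin (Bool.rec m n b))))

end FreeDVS

theorem mainTheorem2 {m n : ℕ}
    (U : TopologicalSpace.Opens (EuclideanSpace ℝ (Fin m)))
    (V : TopologicalSpace.Opens (EuclideanSpace ℝ (Fin n)))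
    {ι : Type*} [Finite ι] (d : ι → ℕ)
    (W : ∀ i, TopologicalSpace.Opens (EuclideanSpace ℝ (Fin (d i)))) :
    -- two factors
    (IsKOmega (dTopology : TopologicalSpace (FreeDVS U)) ∧
      IsKOmega (dTopology : TopologicalSpace (FreeDVS V)) ∧
      (dTopology : TopologicalSpace (FreeDVS U × FreeDVS V)) =
        @instTopologicalSpaceProd (FreeDVS U) (FreeDVS V) dTopology dTopology) ∧
    -- finitely many factors
    ((∀ i, IsKOmega (dTopology : TopologicalSpace (FreeDVS (W i)))) ∧
      (dTopology : TopologicalSpace (∀ i, FreeDVS (W i))) =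
        @Pi.topologicalSpace ι (fun i => FreeDVS (W i)) (fun _ => dTopology)) :=
  ⟨⟨FreeDVS.isKOmega_dTopology U, FreeDVS.isKOmega_dTopology V, FreeDVS.dTopology_prod U V⟩,
    fun i => FreeDVS.isKOmega_dTopology (W i), FreeDVS.dTopology_pi d W⟩
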